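/- Let $M$ be a smooth manifold of dimension $2n\ge 4$ and let $G=(g,b)$ be a generalized metric on $TM\oplus T^*M$, i.e. $g$ is a Riemannian metric and $b$ a $2$-form on $M$. Write $gX=g(X,\cdot)$, $bX=b(X,\cdot)$, $g^{-1}:T^*M\to TM$ for the inverse of $X\mapsto gX$, $V^{\pm}=\{X\pm gX+bX\}$, so that $TM\oplus T^*M=V^+\oplus V^-$, and $X^{\pm}=X\pm gX+bX$. Let $[\cdot,\cdot]_C$ be the Courant bracket, $[u,v]_C=\tfrac12([u,v]_D-[v,u]_D)$ with $[X+\xi,Y+\eta]_D=[X,Y]+\mathcal L_X\eta-\iota_Y d\xi$, and let $\nabla^+$ be the affine connection $$\nabla^+_XY=\pi\big(([X^-,Y^+]_C)_+\big),$$ where $(\cdot)_+$ is the projection onto $V^+$ along $V^-$ and $\pi:TM\oplus T^*M\to TM$ is the projection. Let $A$ be the endomorphism of $TM$ with $g(AX,Y)=b(X,Y)$, let $Q=-A^2$, and let $db(X,Y)$ denote the $1$-form $db(X,Y,\cdot)$. Suppose that $b$ is non-degenerate, that $\nabla^+b=0$, and that for all smooth vector fields $X,Y,Z$ $$b\big(g^{-1}(db(X,AY))-g^{-1}(db(AX,Y)),Z\big)+b\big(g^{-1}(db(AY,Z)),X\big)-b\big(g^{-1}(db(Y,Z)),AX\big)-b\big(g^{-1}(db(Z,AX)),Y\big)+b\big(g^{-1}(db(Z,X)),AY\big)=0.$$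 Then $(M,g,A,Q)$ is a weak nearly Kähler manifold: $\dim M=2n\ge4$, $A$ is a smooth, $g$-skew-symmetric, non-singular endomorphism of $TM$, $Q=-A^2$, and $(\nabla^{LC}_XA)X=0$ for every smooth vector field $X$, equivalently $(\nabla^{LC}_XF)(X,Y)=0$ for all smooth vector fields $X,Y$, where $\nabla^{LC}$ is the Levi-Civita connection of $g$ and $F(X,Y)=g(AX,Y)$. -/

import Mathlib

open Bundle Manifold VectorField
open scoped ContDiff Topology

namespace GenGeom

section Calculus

variable {E : Type*} [NormedAddCommGroup E] [NormedSpace ℝ E]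
  {M : Type*} [TopologicalSpace M] [ChartedSpace E M]

variable (E M) in
/-- (Not necessarily smooth) vector fields on a manifold `M` modelled on `E`. -/
abbrev VField : Type _ := Π x : M, TangentSpace 𝓘(ℝ, E) x

variable (E M) in
/-- (Not necessarily smooth) `1`-forms on `M`. -/
abbrev OneForm : Type _ := Π x : M, TangentSpace 𝓘(ℝ, E) x →L[ℝ] ℝ

variable (E M) in
/-- (Not necessarily smooth) fields of bilinear forms on the tangent spaces of `M`. -/
abbrev BilinField : Type _ :=
  Π x : M, TangentSpace 𝓘(ℝ, E) x →L[ℝ] TangentSpace 𝓘(ℝ, E) x →L[ℝ] ℝ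

variable (E M) in
/-- (Not necessarily smooth) fields of endomorphisms of the tangent spaces of `M`. -/
abbrev EndField : Type _ :=
  Π x : M, TangentSpace 𝓘(ℝ, E) x →L[ℝ] TangentSpace 𝓘(ℝ, E) x

/-- The vector field `A X`. -/
noncomputable def EndField.app (A : EndField E M) (X : VField E M) : VField E M := fun x => A x (X x)

/-- The derivative `X f` of a function `f` along a vector field `X`. -/
noncomputable def dir (X : VField E M) (f : M → ℝ) : M → ℝ := fun x => mvfderiv 𝓘(ℝ, E) f x (X x)

theorem dir_mul {X : VField E M} {f h : M → ℝ} {x : M} (hf : MDiffAt f x) (hh : MDiffAt h x) :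
   dir X (fun y => f y * h y) x = f x * dir X h x + h x * dir X f x := by
  simp [dir, mvfderiv_fun_mul hf hh]

theorem dir_add {X : VField E M} {f h : M → ℝ} {x : M} (hf : MDiffAt f x) (hh : MDiffAt h x) :
   dir X (fun y => f y + h y) x = dir X f x + dir X h x := by
  simp [dir, mvfderiv_fun_add hf hh]

section Smooth

variable [IsManifold 𝓘(ℝ, E) ∞ M]

/-- `X` is a smooth section of `TM`. -/
def SmoothVF (X : VField E M) : Prop :=
  ContMDiff 𝓘(ℝ, E) (𝓘(ℝ, E).prod 𝓘(ℝ, E)) ∞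
    (fun x => TotalSpace.mk' E (E := (TangentSpace 𝓘(ℝ, E) : M → Type _)) x (X x))

/-- `A` is a smooth section of `End(TM)`. -/
def SmoothEnd (A : EndField E M) : Prop :=
  ContMDiff 𝓘(ℝ, E) (𝓘(ℝ, E).prod 𝓘(ℝ, E →L[ℝ] E)) ∞
    (fun x => TotalSpace.mk' (E →L[ℝ] E)
      (E := fun x : M => TangentSpace 𝓘(ℝ, E) x →L[ℝ] TangentSpace 𝓘(ℝ, E) x) x (A x))

/-- `b` is a smooth section of the bundle of bilinear forms on `TM`. -/
def SmoothBilin (b : BilinField E M) : Prop :=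
  ContMDiff 𝓘(ℝ, E) (𝓘(ℝ, E).prod 𝓘(ℝ, E →L[ℝ] E →L[ℝ] ℝ)) ∞
    (fun x => TotalSpace.mk' (E →L[ℝ] E →L[ℝ] ℝ)
      (E := fun x : M => TangentSpace 𝓘(ℝ, E) x →L[ℝ] TangentSpace 𝓘(ℝ, E) x →L[ℝ] ℝ) x (b x))

theorem SmoothBilin.mdiff {b : BilinField E M} (hb : SmoothBilin b) {X Y : VField E M} {x : M}
    (hX : MDiffAt (T% X) x) (hY : MDiffAt (T% Y) x) : MDiffAt (fun y => b y (X y) (Y y)) x := by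
  have : MDifferentiableAt 𝓘(ℝ, E) (𝓘(ℝ, E).prod 𝓘(ℝ))
      (fun m ↦ TotalSpace.mk' ℝ (E := Bundle.Trivial M ℝ) m (b m (X m) (Y m))) x := by
    apply MDifferentiableAt.clm_bundle_apply₂ (F₁ := E) (F₂ := E)
    · exact (hb x).mdifferentiableAt (by simp)
    · exact hX
    · exact hY
  simp only [mdifferentiableAt_totalSpace] at this
  exact this.2

end Smooth

variable [FiniteDimensional ℝ E] [IsManifold 𝓘(ℝ, E) ∞ M]

open Classical in
/-- The covector at `x` determined by a functional `Φ` on vector fields which is tensorial at `x`,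
i.e. the covector sending `Z x` to `Φ Z` for each `Z` that is differentiable at `x`
(`0` if `Φ` is not tensorial). -/
noncomputable def covectorOf (Φ : VField E M → ℝ) (x : M) : TangentSpace 𝓘(ℝ, E) x →L[ℝ] ℝ :=
  if h : TensorialAt 𝓘(ℝ, E) E Φ x then TensorialAt.mkHom Φ x h else 0

theorem covectorOf_apply {Φ : VField E M → ℝ} {x : M} (h : TensorialAt 𝓘(ℝ, E) E Φ x)
    {Z : VField E M} (hZ : MDiffAt (T% Z) x) : covectorOf Φ x (Z x) = Φ Z := by
  rw [covectorOf, dif_pos h, TensorialAt.mkHom_apply h hZ]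

/-- The exterior derivative of a `1`-form, evaluated on two vector fields:
`dξ(Y, Z) = Y ξ(Z) - Z ξ(Y) - ξ([Y, Z])`. -/
noncomputable def dOne (ξ : OneForm E M) (Y Z : VField E M) : M → ℝ := fun x =>
  dir Y (fun y => ξ y (Z y)) x - dir Z (fun y => ξ y (Y y)) x
    - ξ x (mlieBracket 𝓘(ℝ, E) Y Z x)

/-- The `1`-form `ι_Y dξ`. -/
noncomputable def iotaD (Y : VField E M) (ξ : OneForm E M) : OneForm E M :=
  fun x => covectorOf (fun Z => dOne ξ Y Z x) x

/-- The Lie derivative of a `1`-form: `(L_X η)(Z) = X η(Z) - η([X, Z])`. -/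
noncomputable def lieD (X : VField E M) (η : OneForm E M) : OneForm E M :=
  fun x => covectorOf
    (fun Z => dir X (fun y => η y (Z y)) x - η x (mlieBracket 𝓘(ℝ, E) X Z x)) x

/-- The exterior derivative of a `2`-form, evaluated on three vector fields. -/
noncomputable def dTwo (b : BilinField E M) (X Y Z : VField E M) : M → ℝ := fun x =>
  dir X (fun y => b y (Y y) (Z y)) x + dir Y (fun y => b y (Z y) (X y)) x
    + dir Z (fun y => b y (X y) (Y y)) x
    - b x (mlieBracket 𝓘(ℝ, E) X Y x) (Z x) - b x (mlieBracket 𝓘(ℝ, E) Y Z x) (X x)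
    - b x (mlieBracket 𝓘(ℝ, E) Z X x) (Y x)

/-- The `1`-form `db(X, Y) = db(X, Y, ·)`. -/
noncomputable def dTwoForm (b : BilinField E M) (X Y : VField E M) : OneForm E M :=
  fun x => covectorOf (fun Z => dTwo b X Y Z x) x

/-- `ξ` is differentiable at `x`, tested on vector fields that are differentiable at `x`. -/
def OneForm.DiffAt (ξ : OneForm E M) (x : M) : Prop :=
  ∀ Z : VField E M, MDiffAt (T% Z) x → MDiffAt (fun y => ξ y (Z y)) x

-- The functionals to which `covectorOf` is applied above are tensorial for differentiable data.

theorem lieD_tensorial {X : VField E M} {η : OneForm E M} {x : M} (hη : η.DiffAt x) :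
    TensorialAt 𝓘(ℝ, E) E (fun Z => dir X (fun y => η y (Z y)) x - η x (mlieBracket 𝓘(ℝ, E) X Z x)) x where
  smul {f Z} hf hZ := by
    simp [dir_mul hf (hη Z hZ), mlieBracket_smul_right hf hZ]
    simp [dir]; ring
  add {Z W} hZ hW := by
    simp [dir_add (hη Z hZ) (hη W hW), mlieBracket_add_right hZ hW]
    ring

theorem dOne_tensorial {Y : VField E M} {η : OneForm E M} {x : M} (hη : η.DiffAt x) :
    TensorialAt 𝓘(ℝ, E) E (fun Z => dOne η Y Z x) x where
  smul {f Z} hf hZ := by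
    simp [dOne, dir_mul hf (hη Z hZ), mlieBracket_smul_right hf hZ]
    simp [dir]; ring
  add {Z W} hZ hW := by
    simp [dOne, dir_add (hη Z hZ) (hη W hW), mlieBracket_add_right hZ hW]
    simp [dir]; ring

theorem dTwo_tensorial {X Y : VField E M} {b : BilinField E M} (hb : SmoothBilin b)
   (hs : ∀ x v w, b x v w = - b x w v) {x : M}
   (hX : MDiffAt (T% X) x) (hY : MDiffAt (T% Y) x) :
    TensorialAt 𝓘(ℝ, E) E (fun Z => dTwo b X Y Z x) x where
  smul {f Z} hf hZ := by
    simp [dTwo, dir_mul hf (hb.mdiff hY hZ), dir_mul hf (hb.mdiff hZ hX), mlieBracket_smul_right hf hZ, mlieBracket_smul_left hf hZ]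
    simp [dir]
    rw [hs x (Y x) (Z x)]; ring
  add {Z W} hZ hW := by
    simp [dTwo, dir_add (hb.mdiff hY hZ) (hb.mdiff hY hW), dir_add (hb.mdiff hZ hX) (hb.mdiff hW hX), mlieBracket_add_right hZ hW, mlieBracket_add_left hZ hW]
    simp [dir]; ring

/-- A section `X + ξ` of the generalized tangent bundle `TM ⊕ T*M`. -/
abbrev GenSection (E M : Type*) [NormedAddCommGroup E] [NormedSpace ℝ E]
  [TopologicalSpace M] [ChartedSpace E M] : Type _ := VField E M × OneForm E M

/-- The Dorfman bracket `[X + ξ, Y + η]_D = [X, Y] + L_X η - ι_Y dξ`. -/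
noncomputable def dorfman (u v : GenSection E M) : GenSection E M :=
  (mlieBracket 𝓘(ℝ, E) u.1 v.1, lieD u.1 v.2 - iotaD v.1 u.2)

/-- The Courant bracket, the skew-symmetrization of the Dorfman bracket. -/
noncomputable def courant (u v : GenSection E M) : GenSection E M :=
  (1 / 2 : ℝ) • (dorfman u v - dorfman v u)

/-- The covariant derivative `(∇_X b)(Y, Z)` of a bilinear form with respect to `∇`. -/
noncomputable def covBilin (nab : VField E M → VField E M → VField E M) (b : BilinField E M)
    (X Y Z : VField E M) : M → ℝ := fun x =>
  dir X (fun y => b y (Y y) (Z y)) x - b x (nab X Y x) (Z x) - b x (Y x) (nab X Z x)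

/-- The covariant derivative `(∇_X A) Y = ∇_X (A Y) - A (∇_X Y)` of an endomorphism. -/
noncomputable def covEnd (nab : VField E M → VField E M → VField E M) (A : EndField E M)
    (X Y : VField E M) : VField E M := nab X (A.app Y) - A.app (nab X Y)

end Calculus

section Metric

variable {E : Type*} [NormedAddCommGroup E] [NormedSpace ℝ E] [FiniteDimensional ℝ E]
  {M : Type*} [TopologicalSpace M] [ChartedSpace E M] [IsManifold 𝓘(ℝ, E) ∞ M]

variable (E M) in
/-- Smooth Riemannian metrics on `M`. -/
abbrev RMetric : Type _ :=
  ContMDiffRiemannianMetric 𝓘(ℝ, E) ∞ E (TangentSpace 𝓘(ℝ, E) : M → Type _)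

theorem RMetric.inner_bijective (g : RMetric E M) (x : M) : Function.Bijective (g.inner x) := by
  have hinj : Function.Injective (g.inner x) := by
    intro v w h
    by_contra hne
    have h1 := g.pos x (v - w) (sub_ne_zero.mpr hne)
    have h2 : g.inner x (v - w) = 0 := by rw [map_sub, h, sub_self]
    rw [h2] at h1
    simp at h1
  have : FiniteDimensional ℝ (TangentSpace 𝓘(ℝ, E) x) := inferInstanceAs (FiniteDimensional ℝ E)
  have : FiniteDimensional ℝ (TangentSpace 𝓘(ℝ, E) x →L[ℝ] ℝ) :=
    inferInstanceAs (FiniteDimensional ℝ (E →L[ℝ] ℝ))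
  refine ⟨hinj, ?_⟩
  have hdim : Module.finrank ℝ (TangentSpace 𝓘(ℝ, E) x)
      = Module.finrank ℝ (TangentSpace 𝓘(ℝ, E) x →L[ℝ] ℝ) := by
    change Module.finrank ℝ E = Module.finrank ℝ (E →L[ℝ] ℝ)
    rw [← (LinearMap.toContinuousLinearMap (𝕜 := ℝ) (E := E) (F' := ℝ)).finrank_eq]
    exact (Subspace.dual_finrank_eq (K := ℝ) (V := E)).symm
  exact (LinearMap.injective_iff_surjective_of_finrank_eq_finrank
    (f := (g.inner x).toLinearMap) hdim).mp hinj

/-- The musical isomorphism `g⁻¹ : T*M → TM`. -/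
noncomputable def RMetric.sharp (g : RMetric E M) (x : M) :
    (TangentSpace 𝓘(ℝ, E) x →L[ℝ] ℝ) →L[ℝ] TangentSpace 𝓘(ℝ, E) x :=
  haveI : FiniteDimensional ℝ (TangentSpace 𝓘(ℝ, E) x →L[ℝ] ℝ) :=
    inferInstanceAs (FiniteDimensional ℝ (E →L[ℝ] ℝ))
  haveI : T2Space (TangentSpace 𝓘(ℝ, E) x →L[ℝ] ℝ) :=
    inferInstanceAs (T2Space (E →L[ℝ] ℝ))
  haveI : IsTopologicalAddGroup (TangentSpace 𝓘(ℝ, E) x →L[ℝ] ℝ) :=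
    inferInstanceAs (IsTopologicalAddGroup (E →L[ℝ] ℝ))
  LinearMap.toContinuousLinearMap
    ((LinearEquiv.ofBijective (g.inner x).toLinearMap (g.inner_bijective x)).symm.toLinearMap)

theorem RMetric.inner_sharp (g : RMetric E M) (x : M) (κ : TangentSpace 𝓘(ℝ, E) x →L[ℝ] ℝ) :
    g.inner x (g.sharp x κ) = κ :=
  (LinearEquiv.ofBijective (g.inner x).toLinearMap (g.inner_bijective x)).apply_symm_apply κ

/-- The right-hand side of the Koszul formula. -/
noncomputable def RMetric.koszul (g : RMetric E M) (X Y Z : VField E M) : M → ℝ := fun x =>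
  dir X (fun y => g.inner y (Y y) (Z y)) x + dir Y (fun y => g.inner y (X y) (Z y)) x
    - dir Z (fun y => g.inner y (X y) (Y y)) x
    + g.inner x (mlieBracket 𝓘(ℝ, E) X Y x) (Z x)
    - g.inner x (mlieBracket 𝓘(ℝ, E) X Z x) (Y x)
    - g.inner x (mlieBracket 𝓘(ℝ, E) Y Z x) (X x)

/-- The Levi-Civita connection `∇_X Y` of `g`, defined by the Koszul formula. -/
noncomputable def RMetric.leviCivita (g : RMetric E M) (X Y : VField E M) : VField E M :=
  fun x => g.sharp x ((1 / 2 : ℝ) • covectorOf (fun Z => g.koszul X Y Z x) x)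

theorem koszul_tensorial {X Y : VField E M} (g : RMetric E M) {x : M}
   (hX : MDiffAt (T% X) x) (hY : MDiffAt (T% Y) x) :
    TensorialAt 𝓘(ℝ, E) E (fun Z => g.koszul X Y Z x) x where
  smul {f Z} hf hZ := by
    have hb : SmoothBilin g.inner := g.contMDiff
    simp [RMetric.koszul, dir_mul hf (hb.mdiff hY hZ), dir_mul hf (hb.mdiff hX hZ), mlieBracket_smul_right hf hZ]
    simp [dir]
    rw [g.symm x (Z x) (X x), g.symm x (Z x) (Y x)]; ring
  add {Z W} hZ hW := by
    have hb : SmoothBilin g.inner := g.contMDiff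
    simp [RMetric.koszul, dir_add (hb.mdiff hY hZ) (hb.mdiff hY hW), dir_add (hb.mdiff hX hZ) (hb.mdiff hX hW), mlieBracket_add_right hZ hW]
    simp [dir]; ring

theorem RMetric.inner_leviCivita (g : RMetric E M) {X Y Z : VField E M} {x : M}
   (hX : MDiffAt (T% X) x) (hY : MDiffAt (T% Y) x) (hZ : MDiffAt (T% Z) x) :
   g.inner x (g.leviCivita X Y x) (Z x) = 1/2 * g.koszul X Y Z x := by
  simp [RMetric.leviCivita, g.inner_sharp, covectorOf_apply (koszul_tensorial g hX hY) hZ]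

/-- The Levi-Civita connection is compatible with the metric. -/
theorem RMetric.leviCivita_metric (g : RMetric E M) {X Y Z : VField E M} {x : M}
   (hX : MDiffAt (T% X) x) (hY : MDiffAt (T% Y) x) (hZ : MDiffAt (T% Z) x) :
   covBilin g.leviCivita g.inner X Y Z x = 0 := by
  have h1 : ∀ U V : VField E M, (fun y => g.inner y (U y) (V y)) = (fun y => g.inner y (V y) (U y)) := fun U V => funext fun y => g.symm _ _ _
  have h2 := fun U V => mlieBracket_swap_apply (I := 𝓘(ℝ, E)) (V := U) (W := V) (x := x)
  rw [covBilin, g.symm x (Y x), RMetric.inner_leviCivita g hX hY hZ, RMetric.inner_leviCivita g hX hZ hY]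
  simp only [RMetric.koszul]
  rw [h1 Z Y, h1 X Z, h1 X Y, h2 Z Y]
  simp
  ring

/-- The Levi-Civita connection is torsion-free. -/
theorem RMetric.leviCivita_torsion (g : RMetric E M) {X Y : VField E M} {x : M}
   (hX : MDiffAt (T% X) x) (hY : MDiffAt (T% Y) x) :
   g.leviCivita X Y x - g.leviCivita Y X x = mlieBracket 𝓘(ℝ, E) X Y x := by
  apply (g.inner_bijective x).1
  ext v
  obtain ⟨Z, hZ, rfl⟩ : ∃ Z : VField E M, MDiffAt (T% Z) x ∧ Z x = v := ⟨FiberBundle.extend E v, FiberBundle.mdifferentiableAt_extend .., by simp⟩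
  rw [map_sub, sub_apply, RMetric.inner_leviCivita g hX hY hZ, RMetric.inner_leviCivita g hY hX hZ]
  have h1 : ∀ U V : VField E M, (fun y => g.inner y (U y) (V y)) = (fun y => g.inner y (V y) (U y)) := fun U V => funext fun y => g.symm _ _ _
  have h2 := fun U V => mlieBracket_swap_apply (I := 𝓘(ℝ, E)) (V := U) (W := V) (x := x)
  simp only [RMetric.koszul]
  rw [h1 Y X, h2 Y X]
  simp
  ring

/-- The `2`-form `F(X, Y) = g(A X, Y)`. -/
noncomputable def RMetric.fundForm (g : RMetric E M) (A : EndField E M) : BilinField E M :=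
  fun x => (g.inner x).comp (A x)

/-- `(M, g, A)` is a weak almost Hermitian manifold: `dim M = 2n ≥ 4` and `A` is a smooth
`g`-skew-symmetric non-singular endomorphism of `TM`. -/
structure IsWeakAlmostHermitian (g : RMetric E M) (A : EndField E M) : Prop where
  dim : ∃ n : ℕ, 2 ≤ n ∧ Module.finrank ℝ E = 2 * n
  smooth : SmoothEnd A
  skew : ∀ (x : M) (v w : TangentSpace 𝓘(ℝ, E) x), g.inner x (A x v) w = - g.inner x v (A x w)
  nonsingular : ∀ x : M, Function.Bijective (A x)

/-- `(M, g, A, Q)` is a weak nearly Kähler manifold: `(M, g, A)` is weak almost Hermitian,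
`Q = -A²` and `(∇_X A) X = 0` for the Levi-Civita connection `∇`, equivalently
`(∇_X F)(X, Y) = 0` for the fundamental form `F(X, Y) = g(A X, Y)`; both forms are recorded. -/
structure IsWeakNearlyKahler (g : RMetric E M) (A Q : EndField E M) : Prop
    extends IsWeakAlmostHermitian g A where
  Q_eq : ∀ (x : M) (v : TangentSpace 𝓘(ℝ, E) x), Q x v = - A x (A x v)
  covEnd_eq_zero : ∀ X : VField E M, SmoothVF X → covEnd g.leviCivita A X X = 0
  covFundForm_eq_zero : ∀ X Y : VField E M, SmoothVF X → SmoothVF Y →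
    covBilin g.leviCivita (g.fundForm A) X X Y = 0

variable (E M) in
/-- A generalized metric on `TM ⊕ T*M`, given by a Riemannian metric `g` and a `2`-form `b`. Its
positive definite subbundle is `V⁺ = {X + g X + b X}`, where `g X = g(X, ·)` and `b X = b(X, ·)`;
the orthogonal complement is `V⁻ = {X - g X + b X}`. -/
structure GeneralizedMetric where
  g : RMetric E M
  b : BilinField E M
  b_alt : ∀ (x : M) (v : TangentSpace 𝓘(ℝ, E) x), b x v v = 0
  b_smooth : SmoothBilin b

namespace GeneralizedMetric

variable (G : GeneralizedMetric E M)

/-- `X⁺ = X + g X + b X`, a section of `V⁺`. -/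
noncomputable def plus (X : VField E M) : GenSection E M := (X, fun x => G.g.inner x (X x) + G.b x (X x))

/-- `X⁻ = X - g X + b X`, a section of `V⁻`. -/
noncomputable def minus (X : VField E M) : GenSection E M := (X, fun x => - G.g.inner x (X x) + G.b x (X x))

/-- The endomorphism `G` of `TM ⊕ T*M`, with blocks `-g⁻¹b`, `g⁻¹`, `g - b g⁻¹ b`, `b g⁻¹`. -/
noncomputable def endo (u : GenSection E M) : GenSection E M :=
  (fun x => - G.g.sharp x (G.b x (u.1 x)) + G.g.sharp x (u.2 x),
   fun x => G.g.inner x (u.1 x) - G.b x (G.g.sharp x (G.b x (u.1 x))) + G.b x (G.g.sharp x (u.2 x)))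

/-- The projection `u ↦ u₊ = (u + G u) / 2` onto `V⁺` along `V⁻`. -/
noncomputable def projPlus (u : GenSection E M) : GenSection E M := (1 / 2 : ℝ) • (u + G.endo u)

theorem projPlus_plus (X : VField E M) : G.projPlus (G.plus X) = G.plus X := by
  have h1 : ∀ x v, G.g.sharp x (G.g.inner x v) = v := fun x v =>
    (G.g.inner_bijective x).1 (G.g.inner_sharp x _)
  have h : G.endo (G.plus X) = G.plus X := by
    refine Prod.ext (funext fun x => ?_) (funext fun x => ?_)
    · simp [endo, plus, h1]
    · simp [endo, plus, h1, map_add]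
  rw [projPlus, h, ← two_smul ℝ, smul_smul]
  norm_num

theorem projPlus_minus (X : VField E M) : G.projPlus (G.minus X) = 0 := by
  have h1 : ∀ x v, G.g.sharp x (G.g.inner x v) = v := fun x v =>
    (G.g.inner_bijective x).1 (G.g.inner_sharp x _)
  have h : G.endo (G.minus X) = - G.minus X := by
    refine Prod.ext (funext fun x => ?_) (funext fun x => ?_)
    · simp [endo, minus, h1]
    · simp [endo, minus, h1, map_add, add_comm]
  rw [projPlus, h, add_neg_cancel, smul_zero]

/-- The affine connection `∇⁺_X Y = π(([X⁻, Y⁺]_C)₊)` induced by the generalized metric, where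
`π : TM ⊕ T*M → TM` is the projection. -/
noncomputable def nablaPlus (X Y : VField E M) : VField E M :=
  (G.projPlus (courant (G.minus X) (G.plus Y))).1

/-- The endomorphism `A = g⁻¹ b`, i.e. `g(A X, Y) = b(X, Y)`. -/
noncomputable def A : EndField E M := fun x => (G.g.sharp x).comp (G.b x)

theorem inner_A (x : M) (v w : TangentSpace 𝓘(ℝ, E) x) : G.g.inner x (G.A x v) w = G.b x v w := by
  simp [A, G.g.inner_sharp]

/-- `Q = -A²`. -/
noncomputable def Q : EndField E M := fun x => - (G.A x).comp (G.A x)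

/-- The vector field `g⁻¹(db(X, Y))`. -/
noncomputable def sharpD (X Y : VField E M) : VField E M :=
  fun x => G.g.sharp x (dTwoForm G.b X Y x)

/-- `b` is non-degenerate at each point. -/
def NonDegenerate : Prop :=
  ∀ (x : M) (v : TangentSpace 𝓘(ℝ, E) x), (∀ w : TangentSpace 𝓘(ℝ, E) x, G.b x v w = 0) → v = 0

/-- `∇⁺ b = 0`. -/
def NablaPlusBZero : Prop :=
  ∀ X Y Z : VField E M, SmoothVF X → SmoothVF Y → SmoothVF Z →
    covBilin G.nablaPlus G.b X Y Z = 0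

end GeneralizedMetric

end Metric

end GenGeom

/-!
The connection `∇⁺` is the metric connection whose torsion is the `3`-form `db`, so that
`∇⁺_X Y = ∇_X Y + ½ g⁻¹(db(X, Y))` with `∇` the Levi-Civita connection. Hence `∇⁺b = 0` reads
`2 (∇_X b)(Y, Z) = db(X, Z, AY) - db(X, Y, AZ)`, and since `db` is the cyclic sum of `∇b`,
`db(AX, Y, Z) + db(X, AY, Z) + db(X, Y, AZ) = -db(X, Y, Z)`. The left-hand side is the derivation
of trilinear forms induced by the skew endomorphism `A`; it is itself skew, so `-1` is not an
eigenvalue and `db = 0`. Therefore `∇b = 0`, and with it `∇A = 0`.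
-/

namespace GenGeom

section SkewEndomorphism

variable {V : Type*} [NormedAddCommGroup V] [InnerProductSpace ℝ V] {A : V →L[ℝ] V}

theorem sum_apply_map_mul_apply_eq_zero {ι : Type*} [Fintype ι] (e : OrthonormalBasis ι ℝ V)
    (hA : ∀ v, inner ℝ (A v) v = 0) (φ : V →L[ℝ] ℝ) : ∑ i, φ (A (e i)) * φ (e i) = 0 := by
  set u : V := ∑ i, φ (e i) • e i with hu
  have hφ (v : V) : φ v = inner ℝ v u := by
    conv_lhs => rw [← e.sum_repr' v]
    simp [hu, inner_sum, inner_smul_right, real_inner_comm, mul_comm]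
  calc ∑ i, φ (A (e i)) * φ (e i) = φ (A u) := by simp [hu, mul_comm]
    _ = 0 := by rw [hφ, hA]

theorem trilinear_eq_zero_of_derivation_eq_mul [FiniteDimensional ℝ V]
    (hA : ∀ v, inner ℝ (A v) v = 0) {c : ℝ} (hc : c ≠ 0) {T : V →L[ℝ] V →L[ℝ] V →L[ℝ] ℝ}
    (hT : ∀ u v w, T (A u) v w + T u (A v) w + T u v (A w) = c * T u v w) : T = 0 := by
  let e := stdOrthonormalBasis ℝ V
  have hfst : ∑ i, ∑ j, ∑ k, T (A (e i)) (e j) (e k) * T (e i) (e j) (e k) = 0 := by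
    rw [Finset.sum_comm]
    refine Finset.sum_eq_zero fun j _ => ?_
    rw [Finset.sum_comm]
    exact Finset.sum_eq_zero fun k _ =>
      sum_apply_map_mul_apply_eq_zero e hA ((T.flip (e j)).flip (e k))
  have hsnd : ∑ i, ∑ j, ∑ k, T (e i) (A (e j)) (e k) * T (e i) (e j) (e k) = 0 := by
    refine Finset.sum_eq_zero fun i _ => ?_
    rw [Finset.sum_comm]
    exact Finset.sum_eq_zero fun k _ =>
      sum_apply_map_mul_apply_eq_zero e hA ((T (e i)).flip (e k))
  have hthd : ∑ i, ∑ j, ∑ k, T (e i) (e j) (A (e k)) * T (e i) (e j) (e k) = 0 :=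
    Finset.sum_eq_zero fun i _ => Finset.sum_eq_zero fun j _ =>
      sum_apply_map_mul_apply_eq_zero e hA (T (e i) (e j))
  -- Pairing the eigenvalue equation `hT` with `T` kills its left-hand side.
  have hnorm : ∑ i, ∑ j, ∑ k, T (e i) (e j) (e k) ^ 2 = 0 := by
    refine (mul_eq_zero.mp ?_).resolve_left hc
    calc c * ∑ i, ∑ j, ∑ k, T (e i) (e j) (e k) ^ 2
        = ∑ i, ∑ j, ∑ k, (T (A (e i)) (e j) (e k) + T (e i) (A (e j)) (e k)
            + T (e i) (e j) (A (e k))) * T (e i) (e j) (e k) := by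
          simp only [Finset.mul_sum, hT, sq, mul_assoc]
      _ = 0 := by simp only [add_mul, Finset.sum_add_distrib, hfst, hsnd, hthd, add_zero]
  have hcoord (i j k) : T (e i) (e j) (e k) = 0 := by
    have hi := (Finset.sum_eq_zero_iff_of_nonneg fun _ _ => by positivity).mp hnorm i (by simp)
    have hj := (Finset.sum_eq_zero_iff_of_nonneg fun _ _ => by positivity).mp hi j (by simp)
    have hk := (Finset.sum_eq_zero_iff_of_nonneg fun _ _ => by positivity).mp hj k (by simp)
    exact pow_eq_zero_iff two_ne_zero |>.mp hk
  refine ContinuousLinearMap.coe_injective <| e.toBasis.ext fun i => ?_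
  refine ContinuousLinearMap.coe_injective <| e.toBasis.ext fun j => ?_
  refine ContinuousLinearMap.coe_injective <| e.toBasis.ext fun k => ?_
  simpa using hcoord i j k

end SkewEndomorphism

section BundleIsomorphism

variable {𝕜 B F₁ F₂ F₃ : Type*} [NontriviallyNormedField 𝕜] {n : WithTop ℕ∞}
  [NormedAddCommGroup F₁] [NormedSpace 𝕜 F₁] [NormedAddCommGroup F₂] [NormedSpace 𝕜 F₂]
  [NormedAddCommGroup F₃] [NormedSpace 𝕜 F₃]
  {V₁ : B → Type*} [∀ x, AddCommGroup (V₁ x)] [∀ x, Module 𝕜 (V₁ x)]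
  [TopologicalSpace (TotalSpace F₁ V₁)] [∀ x, TopologicalSpace (V₁ x)]
  {V₂ : B → Type*} [∀ x, AddCommGroup (V₂ x)] [∀ x, Module 𝕜 (V₂ x)]
  [TopologicalSpace (TotalSpace F₂ V₂)] [∀ x, TopologicalSpace (V₂ x)]
  {V₃ : B → Type*} [∀ x, AddCommGroup (V₃ x)] [∀ x, Module 𝕜 (V₃ x)]
  [TopologicalSpace (TotalSpace F₃ V₃)] [∀ x, TopologicalSpace (V₃ x)]
  [TopologicalSpace B] [FiberBundle F₁ V₁] [VectorBundle 𝕜 F₁ V₁]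
  [FiberBundle F₂ V₂] [VectorBundle 𝕜 F₂ V₂] [FiberBundle F₃ V₃] [VectorBundle 𝕜 F₃ V₃]

open ContinuousLinearMap

theorem inCoordinates_continuousLinearEquiv {x₀ x : B} (φ : V₂ x ≃L[𝕜] V₃ x)
    (h₂ : x ∈ (trivializationAt F₂ V₂ x₀).baseSet) (h₃ : x ∈ (trivializationAt F₃ V₃ x₀).baseSet) :
    inCoordinates F₂ V₂ F₃ V₃ x₀ x x₀ x (φ : V₂ x →L[𝕜] V₃ x) =
      ((((trivializationAt F₂ V₂ x₀).continuousLinearEquivAt 𝕜 x h₂).symm.trans φ).trans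
        ((trivializationAt F₃ V₃ x₀).continuousLinearEquivAt 𝕜 x h₃) : F₂ →L[𝕜] F₃) := by
  rw [inCoordinates_eq h₂ h₃]
  rfl

theorem inCoordinates_symm_comp {x₀ x : B} (φ : V₂ x ≃L[𝕜] V₃ x) (ψ : V₁ x →L[𝕜] V₃ x)
    (h₁ : x ∈ (trivializationAt F₁ V₁ x₀).baseSet) (h₂ : x ∈ (trivializationAt F₂ V₂ x₀).baseSet)
    (h₃ : x ∈ (trivializationAt F₃ V₃ x₀).baseSet) :
    inCoordinates F₁ V₁ F₂ V₂ x₀ x x₀ x ((φ.symm : V₃ x →L[𝕜] V₂ x).comp ψ) =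
      (inverse (inCoordinates F₂ V₂ F₃ V₃ x₀ x x₀ x (φ : V₂ x →L[𝕜] V₃ x))).comp
        (inCoordinates F₁ V₁ F₃ V₃ x₀ x x₀ x ψ) := by
  rw [inCoordinates_continuousLinearEquiv φ h₂ h₃, inverse_equiv, inCoordinates_eq h₁ h₂,
    inCoordinates_eq h₁ h₃]
  ext v
  simp only [comp_apply, ContinuousLinearEquiv.coe_coe, ContinuousLinearEquiv.symm_trans_apply,
    ContinuousLinearEquiv.symm_apply_apply, ContinuousLinearEquiv.symm_symm]

variable {EB : Type*} [NormedAddCommGroup EB] [NormedSpace 𝕜 EB] {HB : Type*}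
  [TopologicalSpace HB] {IB : ModelWithCorners 𝕜 EB HB} [ChartedSpace HB B]
  [∀ x, IsTopologicalAddGroup (V₂ x)] [∀ x, ContinuousSMul 𝕜 (V₂ x)]
  [∀ x, IsTopologicalAddGroup (V₃ x)] [∀ x, ContinuousSMul 𝕜 (V₃ x)] [CompleteSpace F₂]

theorem contMDiffAt_symm_comp {φ : ∀ x, V₂ x ≃L[𝕜] V₃ x} {ψ : ∀ x, V₁ x →L[𝕜] V₃ x} {x₀ : B}
    (hφ : ContMDiffAt IB (IB.prod 𝓘(𝕜, F₂ →L[𝕜] F₃)) n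
      (fun x => TotalSpace.mk' (F₂ →L[𝕜] F₃) (E := fun x => V₂ x →L[𝕜] V₃ x) x (φ x)) x₀)
    (hψ : ContMDiffAt IB (IB.prod 𝓘(𝕜, F₁ →L[𝕜] F₃)) n
      (fun x => TotalSpace.mk' (F₁ →L[𝕜] F₃) (E := fun x => V₁ x →L[𝕜] V₃ x) x (ψ x)) x₀) :
    ContMDiffAt IB (IB.prod 𝓘(𝕜, F₁ →L[𝕜] F₂)) n
      (fun x => TotalSpace.mk' (F₁ →L[𝕜] F₂) (E := fun x => V₁ x →L[𝕜] V₂ x) x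
        (((φ x).symm : V₃ x →L[𝕜] V₂ x).comp (ψ x))) x₀ := by
  rw [contMDiffAt_hom_bundle] at hφ hψ ⊢
  have hinv : IsInvertible (inCoordinates F₂ V₂ F₃ V₃ x₀ x₀ x₀ x₀ (φ x₀ : V₂ x₀ →L[𝕜] V₃ x₀)) :=
    ⟨_, (inCoordinates_continuousLinearEquiv (φ x₀)
      (FiberBundle.mem_baseSet_trivializationAt' x₀)
      (FiberBundle.mem_baseSet_trivializationAt' x₀)).symm⟩
  have hinverse := ContDiffAt.comp_contMDiffAt (g := inverse)
    (f := fun x => inCoordinates F₂ V₂ F₃ V₃ x₀ x x₀ x (φ x : V₂ x →L[𝕜] V₃ x))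
    (hinv.contDiffAt_map_inverse (n := n)) hφ.2
  refine ⟨contMDiffAt_id, (hinverse.clm_comp hψ.2).congr_of_eventuallyEq ?_⟩
  filter_upwards [(trivializationAt F₁ V₁ x₀).open_baseSet.mem_nhds
      (FiberBundle.mem_baseSet_trivializationAt' x₀),
    (trivializationAt F₂ V₂ x₀).open_baseSet.mem_nhds
      (FiberBundle.mem_baseSet_trivializationAt' x₀),
    (trivializationAt F₃ V₃ x₀).open_baseSet.mem_nhds
      (FiberBundle.mem_baseSet_trivializationAt' x₀)] with x h₁ h₂ h₃
  exact inCoordinates_symm_comp (φ x) (ψ x) h₁ h₂ h₃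

end BundleIsomorphism


section Extension

variable {E : Type*} [NormedAddCommGroup E] [NormedSpace ℝ E] [FiniteDimensional ℝ E]
  {H : Type*} [TopologicalSpace H] {I : ModelWithCorners ℝ E H}
  {M : Type*} [TopologicalSpace M] [ChartedSpace H M] [IsManifold I ∞ M] [T2Space M]
  {F : Type*} [NormedAddCommGroup F] [NormedSpace ℝ F]
  {V : M → Type*} [TopologicalSpace (TotalSpace F V)] [∀ x, AddCommGroup (V x)]
  [∀ x, Module ℝ (V x)] [∀ x, TopologicalSpace (V x)] [FiberBundle F V] [VectorBundle ℝ F V]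
  [ContMDiffVectorBundle ∞ F V I]

theorem exists_contMDiff_section_eq {x : M} (v : V x) :
    ∃ s : Π x : M, V x, ContMDiff I (I.prod 𝓘(ℝ, F)) ∞ (fun x => TotalSpace.mk' F x (s x)) ∧
      s x = v := by
  obtain ⟨u, hu, hsmooth⟩ := FiberBundle.exists_contMDiffOn_extend (k := ∞) I F v
  obtain ⟨t, htu, ht, hxt⟩ := mem_nhds_iff.mp hu
  obtain ⟨f, hf, -⟩ := (SmoothBumpFunction.nhds_basis_support (I := I)
    (ht.mem_nhds hxt)).mem_iff.mp Filter.univ_mem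
  exact ⟨fun y => f y • FiberBundle.extend F v y, ContMDiffOn.smul_section_of_tsupport
    (f.contMDiff.contMDiffOn (s := t)) ht hf (hsmooth.mono htu), by simp⟩

end Extension

section VectorFields

variable {E : Type*} [NormedAddCommGroup E] [NormedSpace ℝ E]
  {M : Type*} [TopologicalSpace M] [ChartedSpace E M]

theorem dir_neg (X : VField E M) (f : M → ℝ) (x : M) : dir X (fun y => -f y) x = -dir X f x := by
  simp [dir, mvfderiv_fun_neg]

section Smooth

variable [IsManifold 𝓘(ℝ, E) ∞ M]

theorem SmoothVF.mdiff {X : VField E M} (hX : SmoothVF X) (x : M) : MDiffAt (T% X) x :=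
  (hX x).mdifferentiableAt (by simp)

theorem SmoothEnd.app {A : EndField E M} (hA : SmoothEnd A) {X : VField E M} (hX : SmoothVF X) :
    SmoothVF (A.app X) := fun x => (hA x).clm_bundle_apply (hX x)

theorem SmoothEnd.mdiff_app {A : EndField E M} (hA : SmoothEnd A) {X : VField E M} {x : M}
    (hX : MDiffAt (T% X) x) : MDiffAt (T% (A.app X)) x :=
  ((hA x).mdifferentiableAt (by simp)).clm_bundle_apply hX

theorem exists_mdiffAt_eq (x : M) (v : TangentSpace 𝓘(ℝ, E) x) :
    ∃ X : VField E M, MDiffAt (T% X) x ∧ X x = v :=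
  ⟨FiberBundle.extend E v, FiberBundle.mdifferentiableAt_extend .., by simp⟩

theorem exists_smoothVF_eq [FiniteDimensional ℝ E] [T2Space M] (x : M)
    (v : TangentSpace 𝓘(ℝ, E) x) : ∃ X : VField E M, SmoothVF X ∧ X x = v :=
  exists_contMDiff_section_eq v

end Smooth

end VectorFields
section Metric

variable {E : Type*} [NormedAddCommGroup E] [NormedSpace ℝ E]
  {M : Type*} [TopologicalSpace M] [ChartedSpace E M] [IsManifold 𝓘(ℝ, E) ∞ M]

theorem RMetric.smoothBilin (g : RMetric E M) : SmoothBilin g.inner := g.contMDiff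

theorem RMetric.dir_inner_comm (g : RMetric E M) (X Y Z : VField E M) (x : M) :
    dir X (fun y => g.inner y (Y y) (Z y)) x = dir X (fun y => g.inner y (Z y) (Y y)) x :=
  congrArg (fun f => dir X f x) (funext fun y => g.symm y (Y y) (Z y))

variable [FiniteDimensional ℝ E]

theorem RMetric.sharp_inner (g : RMetric E M) (x : M) (v : TangentSpace 𝓘(ℝ, E) x) :
    g.sharp x (g.inner x v) = v :=
  (g.inner_bijective x).1 (g.inner_sharp x _)

/-- The musical isomorphism `X ↦ gX` from tangent vectors to covectors, with inverse `g.sharp`. -/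
noncomputable def RMetric.flatEquiv (g : RMetric E M) (x : M) :
    TangentSpace 𝓘(ℝ, E) x ≃L[ℝ] (TangentSpace 𝓘(ℝ, E) x →L[ℝ] ℝ) :=
  ContinuousLinearEquiv.equivOfInverse (g.inner x) (g.sharp x) (g.sharp_inner x) (g.inner_sharp x)

theorem RMetric.smoothEnd_sharp_comp (g : RMetric E M) {b : BilinField E M} (hb : SmoothBilin b) :
    SmoothEnd (fun x => (g.sharp x).comp (b x)) :=
  fun x => contMDiffAt_symm_comp (φ := g.flatEquiv) (g.smoothBilin x) (hb x)

end Metric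

section TwoForm

variable {E : Type*} [NormedAddCommGroup E] [NormedSpace ℝ E]
  {M : Type*} [TopologicalSpace M] [ChartedSpace E M] {b : BilinField E M}

theorem dTwo_cycle (b : BilinField E M) (X Y Z : VField E M) (x : M) :
    dTwo b X Y Z x = dTwo b Y Z X x := by
  simp only [dTwo]
  ring

theorem dir_apply_swap (hs : ∀ x v w, b x v w = -b x w v) (X Y Z : VField E M) (x : M) :
    dir X (fun y => b y (Y y) (Z y)) x = -dir X (fun y => b y (Z y) (Y y)) x := by
  rw [← dir_neg]
  exact congrArg (fun f => dir X f x) (funext fun y => hs y (Y y) (Z y))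

theorem dTwo_swap (hs : ∀ x v w, b x v w = -b x w v) (X Y Z : VField E M) (x : M) :
    dTwo b X Y Z x = -dTwo b Y X Z x := by
  have hbracket (U V : VField E M) :=
    mlieBracket_swap_apply (I := 𝓘(ℝ, E)) (V := U) (W := V) (x := x)
  simp only [dTwo]
  rw [dir_apply_swap hs X Y Z, dir_apply_swap hs Y Z X, dir_apply_swap hs Z X Y, hbracket X Y,
    hbracket Y Z, hbracket Z X]
  simp only [map_neg, neg_apply]
  ring

variable [FiniteDimensional ℝ E] [IsManifold 𝓘(ℝ, E) ∞ M]

theorem dTwoForm_apply (hb : SmoothBilin b) (hs : ∀ x v w, b x v w = -b x w v)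
    {X Y Z : VField E M} {x : M} (hX : MDiffAt (T% X) x) (hY : MDiffAt (T% Y) x)
    (hZ : MDiffAt (T% Z) x) : dTwoForm b X Y x (Z x) = dTwo b X Y Z x :=
  covectorOf_apply (dTwo_tensorial hb hs hX hY) hZ

theorem dTwoForm_tensorial_right (hb : SmoothBilin b) (hs : ∀ x v w, b x v w = -b x w v)
    {X : VField E M} {x : M} (hX : MDiffAt (T% X) x) :
    TensorialAt 𝓘(ℝ, E) E (fun Y => dTwoForm b X Y x) x where
  smul {f Y} hf hY := by
    ext v
    obtain ⟨Z, hZ, rfl⟩ := exists_mdiffAt_eq x v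
    rw [smul_apply, dTwoForm_apply hb hs hX (hf.smul_section hY) hZ, dTwoForm_apply hb hs hX hY hZ,
      ← dTwo_cycle b Z X, ← dTwo_cycle b Z X]
    exact (dTwo_tensorial hb hs hZ hX).smul hf hY
  add {Y W} hY hW := by
    ext v
    obtain ⟨Z, hZ, rfl⟩ := exists_mdiffAt_eq x v
    rw [add_apply, dTwoForm_apply hb hs hX (mdifferentiableAt_add_section hY hW) hZ,
      dTwoForm_apply hb hs hX hY hZ,
      dTwoForm_apply hb hs hX hW hZ, ← dTwo_cycle b Z X, ← dTwo_cycle b Z X, ← dTwo_cycle b Z X]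
    exact (dTwo_tensorial hb hs hZ hX).add hY hW

theorem dTwoForm_tensorial_left (hb : SmoothBilin b) (hs : ∀ x v w, b x v w = -b x w v)
    {Y : VField E M} {x : M} (hY : MDiffAt (T% Y) x) :
    TensorialAt 𝓘(ℝ, E) E (fun X => dTwoForm b X Y x) x where
  smul {f X} hf hX := by
    ext v
    obtain ⟨Z, hZ, rfl⟩ := exists_mdiffAt_eq x v
    rw [smul_apply, dTwoForm_apply hb hs (hf.smul_section hX) hY hZ, dTwoForm_apply hb hs hX hY hZ,
      dTwo_cycle b _ Y Z, dTwo_cycle b X]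
    exact (dTwo_tensorial hb hs hY hZ).smul hf hX
  add {X W} hX hW := by
    ext v
    obtain ⟨Z, hZ, rfl⟩ := exists_mdiffAt_eq x v
    rw [add_apply, dTwoForm_apply hb hs (mdifferentiableAt_add_section hX hW) hY hZ,
      dTwoForm_apply hb hs hX hY hZ,
      dTwoForm_apply hb hs hW hY hZ, dTwo_cycle b _ Y Z, dTwo_cycle b X, dTwo_cycle b W]
    exact (dTwo_tensorial hb hs hY hZ).add hX hW

/-- The exterior derivative of a `2`-form at the point `x`, as a trilinear form on the tangent
space. -/
noncomputable def dTwoAt (hb : SmoothBilin b) (hs : ∀ x v w, b x v w = -b x w v) (x : M) :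
    TangentSpace 𝓘(ℝ, E) x →L[ℝ] TangentSpace 𝓘(ℝ, E) x →L[ℝ] TangentSpace 𝓘(ℝ, E) x →L[ℝ] ℝ :=
  TensorialAt.mkHom₂ (fun X Y => dTwoForm b X Y x) x
    (fun _ hY => dTwoForm_tensorial_left hb hs hY) (fun _ hX => dTwoForm_tensorial_right hb hs hX)

theorem dTwoAt_apply (hb : SmoothBilin b) (hs : ∀ x v w, b x v w = -b x w v)
    {X Y Z : VField E M} {x : M} (hX : MDiffAt (T% X) x) (hY : MDiffAt (T% Y) x)
    (hZ : MDiffAt (T% Z) x) : dTwoAt hb hs x (X x) (Y x) (Z x) = dTwo b X Y Z x := by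
  rw [dTwoAt, TensorialAt.mkHom₂_apply _ _ hX hY, dTwoForm_apply hb hs hX hY hZ]

theorem dTwo_eq_cyclic_covBilin_leviCivita (g : RMetric E M)
    (hs : ∀ x v w, b x v w = -b x w v) {X Y Z : VField E M} {x : M} (hX : MDiffAt (T% X) x)
    (hY : MDiffAt (T% Y) x) (hZ : MDiffAt (T% Z) x) :
    dTwo b X Y Z x = covBilin g.leviCivita b X Y Z x
      + covBilin g.leviCivita b Y Z X x + covBilin g.leviCivita b Z X Y x := by
  simp only [dTwo, covBilin]
  rw [← g.leviCivita_torsion hX hY, ← g.leviCivita_torsion hY hZ, ← g.leviCivita_torsion hZ hX,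
    hs x (Y x), hs x (Z x), hs x (X x)]
  simp only [map_sub, sub_apply]
  ring

end TwoForm

section CourantBracket

variable {E : Type*} [NormedAddCommGroup E] [NormedSpace ℝ E]
  {M : Type*} [TopologicalSpace M] [ChartedSpace E M] [FiniteDimensional ℝ E]
  [IsManifold 𝓘(ℝ, E) ∞ M]

theorem lieD_apply {η : OneForm E M} {X Z : VField E M} {x : M} (hη : η.DiffAt x)
    (hZ : MDiffAt (T% Z) x) : lieD X η x (Z x) =
      dir X (fun y => η y (Z y)) x - η x (mlieBracket 𝓘(ℝ, E) X Z x) :=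
  covectorOf_apply (lieD_tensorial hη) hZ

theorem iotaD_apply {ξ : OneForm E M} {Y Z : VField E M} {x : M} (hξ : ξ.DiffAt x)
    (hZ : MDiffAt (T% Z) x) : iotaD Y ξ x (Z x) = dOne ξ Y Z x :=
  covectorOf_apply (dOne_tensorial hξ) hZ

theorem courant_fst (u v : GenSection E M) :
    (courant u v).1 = mlieBracket 𝓘(ℝ, E) u.1 v.1 := by
  change (1 / 2 : ℝ) • (mlieBracket 𝓘(ℝ, E) u.1 v.1 - mlieBracket 𝓘(ℝ, E) v.1 u.1) = _
  rw [mlieBracket_swap (V := v.1)]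
  module

theorem courant_snd_apply {u v : GenSection E M} {Z : VField E M} {x : M}
    (hu : u.2.DiffAt x) (hv : v.2.DiffAt x) (hZ : MDiffAt (T% Z) x) :
    (courant u v).2 x (Z x) =
      dir u.1 (fun y => v.2 y (Z y)) x - dir v.1 (fun y => u.2 y (Z y)) x
        - v.2 x (mlieBracket 𝓘(ℝ, E) u.1 Z x) + u.2 x (mlieBracket 𝓘(ℝ, E) v.1 Z x)
        + 1 / 2 * (dir Z (fun y => u.2 y (v.1 y)) x - dir Z (fun y => v.2 y (u.1 y)) x) := by
  have hcourant : (courant u v).2 x (Z x) =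
      1 / 2 * ((lieD u.1 v.2 x (Z x) - iotaD v.1 u.2 x (Z x))
        - (lieD v.1 u.2 x (Z x) - iotaD u.1 v.2 x (Z x))) := rfl
  rw [hcourant, lieD_apply hu hZ, lieD_apply hv hZ, iotaD_apply hu hZ, iotaD_apply hv hZ]
  simp only [dOne]
  ring

end CourantBracket

namespace GeneralizedMetric

variable {E : Type*} [NormedAddCommGroup E] [NormedSpace ℝ E]
  {M : Type*} [TopologicalSpace M] [ChartedSpace E M] [IsManifold 𝓘(ℝ, E) ∞ M]
  (G : GeneralizedMetric E M)

theorem b_swap (x : M) (v w : TangentSpace 𝓘(ℝ, E) x) : G.b x v w = -G.b x w v := by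
  have h := G.b_alt x (v + w)
  simp only [map_add, add_apply, G.b_alt] at h
  linarith

theorem dir_plus_snd {X Y Z : VField E M} {x : M} (hY : MDiffAt (T% Y) x)
    (hZ : MDiffAt (T% Z) x) : dir X (fun y => (G.plus Y).2 y (Z y)) x =
      dir X (fun y => G.g.inner y (Y y) (Z y)) x + dir X (fun y => G.b y (Y y) (Z y)) x :=
  dir_add (G.g.smoothBilin.mdiff hY hZ) (G.b_smooth.mdiff hY hZ)

theorem dir_minus_snd {X Y Z : VField E M} {x : M} (hY : MDiffAt (T% Y) x)
    (hZ : MDiffAt (T% Z) x) : dir X (fun y => (G.minus Y).2 y (Z y)) x =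
      -dir X (fun y => G.g.inner y (Y y) (Z y)) x + dir X (fun y => G.b y (Y y) (Z y)) x := by
  rw [← dir_neg]
  exact dir_add (G.g.smoothBilin.mdiff hY hZ).neg (G.b_smooth.mdiff hY hZ)

theorem diffAt_plus_snd {X : VField E M} {x : M} (hX : MDiffAt (T% X) x) :
    (G.plus X).2.DiffAt x := fun _ hZ =>
  (G.g.smoothBilin.mdiff hX hZ).add (G.b_smooth.mdiff hX hZ)

theorem diffAt_minus_snd {X : VField E M} {x : M} (hX : MDiffAt (T% X) x) :
    (G.minus X).2.DiffAt x := fun _ hZ =>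
  (G.g.smoothBilin.mdiff hX hZ).neg.add (G.b_smooth.mdiff hX hZ)

variable [FiniteDimensional ℝ E]

theorem b_eq_neg_inner_A (x : M) (v w : TangentSpace 𝓘(ℝ, E) x) :
    G.b x v w = -G.g.inner x v (G.A x w) := by
  rw [b_swap, ← G.inner_A, G.g.symm]

theorem smoothEnd_A : SmoothEnd G.A := G.g.smoothEnd_sharp_comp G.b_smooth

theorem inner_projPlus_fst (u : GenSection E M) (x : M) (v : TangentSpace 𝓘(ℝ, E) x) :
    G.g.inner x ((G.projPlus u).1 x) v =
      1 / 2 * (G.g.inner x (u.1 x) v + u.2 x v - G.b x (u.1 x) v) := by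
  simp only [projPlus, endo, Prod.smul_fst, Prod.fst_add, Pi.smul_apply, Pi.add_apply, map_smul,
    map_add, map_neg, G.g.inner_sharp, smul_apply, add_apply, neg_apply, smul_eq_mul]
  ring

theorem courant_minus_plus_snd {X Y Z : VField E M} {x : M} (hX : MDiffAt (T% X) x)
    (hY : MDiffAt (T% Y) x) (hZ : MDiffAt (T% Z) x) :
    (courant (G.minus X) (G.plus Y)).2 x (Z x) =
      dir X (fun y => G.g.inner y (Y y) (Z y)) x + dir Y (fun y => G.g.inner y (X y) (Z y)) x
        - dir Z (fun y => G.g.inner y (X y) (Y y)) x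
        - G.g.inner x (Y x) (mlieBracket 𝓘(ℝ, E) X Z x)
        - G.g.inner x (X x) (mlieBracket 𝓘(ℝ, E) Y Z x)
        + (dir X (fun y => G.b y (Y y) (Z y)) x - dir Y (fun y => G.b y (X y) (Z y)) x
          + dir Z (fun y => G.b y (X y) (Y y)) x
          - G.b x (Y x) (mlieBracket 𝓘(ℝ, E) X Z x) + G.b x (X x) (mlieBracket 𝓘(ℝ, E) Y Z x)) := by
  have hminus := G.dir_minus_snd (X := Z) hX hY
  have hplus := G.dir_plus_snd (X := Z) hY hX
  rw [G.g.dir_inner_comm Z Y X, dir_apply_swap G.b_swap Z Y X] at hplus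
  rw [courant_snd_apply (G.diffAt_minus_snd hX) (G.diffAt_plus_snd hY) hZ, G.dir_minus_snd hX hZ,
    G.dir_plus_snd hY hZ]
  simp only [plus, minus, add_apply, neg_apply] at hplus hminus ⊢
  rw [hplus, hminus]
  ring

theorem inner_nablaPlus {X Y Z : VField E M} {x : M} (hX : MDiffAt (T% X) x)
    (hY : MDiffAt (T% Y) x) (hZ : MDiffAt (T% Z) x) :
    G.g.inner x (G.nablaPlus X Y x) (Z x) =
      G.g.inner x (G.g.leviCivita X Y x) (Z x) + 1 / 2 * dTwo G.b X Y Z x := by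
  have hbracket : mlieBracket 𝓘(ℝ, E) Z X x = -mlieBracket 𝓘(ℝ, E) X Z x :=
    mlieBracket_swap_apply
  rw [nablaPlus, G.inner_projPlus_fst, courant_fst, G.courant_minus_plus_snd hX hY hZ,
    G.g.inner_leviCivita hX hY hZ]
  simp only [RMetric.koszul, dTwo, plus, minus]
  rw [hbracket, dir_apply_swap G.b_swap Y Z X, G.g.symm x (mlieBracket 𝓘(ℝ, E) X Z x),
    G.g.symm x (mlieBracket 𝓘(ℝ, E) Y Z x), G.b_swap x (-mlieBracket 𝓘(ℝ, E) X Z x),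
    G.b_swap x (mlieBracket 𝓘(ℝ, E) Y Z x), map_neg]
  ring

theorem b_nablaPlus {X Y Z : VField E M} {x : M} (hX : MDiffAt (T% X) x) (hY : MDiffAt (T% Y) x)
    (hZ : MDiffAt (T% Z) x) :
    G.b x (G.nablaPlus X Y x) (Z x) =
      G.b x (G.g.leviCivita X Y x) (Z x) - 1 / 2 * dTwo G.b X Y (G.A.app Z) x := by
  have hinner := G.inner_nablaPlus hX hY (G.smoothEnd_A.mdiff_app hZ)
  simp only [EndField.app] at hinner ⊢
  rw [G.b_eq_neg_inner_A, hinner, G.b_eq_neg_inner_A]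
  ring

theorem covBilin_nablaPlus {X Y Z : VField E M} {x : M} (hX : MDiffAt (T% X) x)
    (hY : MDiffAt (T% Y) x) (hZ : MDiffAt (T% Z) x) :
    covBilin G.nablaPlus G.b X Y Z x = covBilin G.g.leviCivita G.b X Y Z x
      + 1 / 2 * (dTwo G.b X Y (G.A.app Z) x - dTwo G.b X Z (G.A.app Y) x) := by
  rw [covBilin, covBilin, G.b_nablaPlus hX hY hZ, G.b_swap x (Y x), G.b_nablaPlus hX hZ hY,
    G.b_swap x (Y x)]
  ring

theorem inner_covEnd_leviCivita {X Y Z : VField E M} {x : M} (hX : MDiffAt (T% X) x)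
    (hY : MDiffAt (T% Y) x) (hZ : MDiffAt (T% Z) x) :
    G.g.inner x (covEnd G.g.leviCivita G.A X Y x) (Z x) =
      covBilin G.g.leviCivita G.b X Y Z x := by
  have hmetric := G.g.leviCivita_metric hX (G.smoothEnd_A.mdiff_app hY) hZ
  simp only [covBilin, covEnd, Pi.sub_apply, EndField.app, map_sub, sub_apply, G.inner_A]
    at hmetric ⊢
  linarith

variable {G}

theorem NablaPlusBZero.covBilin_leviCivita (hpar : G.NablaPlusBZero) {X Y Z : VField E M}
    (hX : SmoothVF X) (hY : SmoothVF Y) (hZ : SmoothVF Z) (x : M) :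
    covBilin G.g.leviCivita G.b X Y Z x =
      1 / 2 * (dTwo G.b X Z (G.A.app Y) x - dTwo G.b X Y (G.A.app Z) x) := by
  have hcov := G.covBilin_nablaPlus (hX.mdiff x) (hY.mdiff x) (hZ.mdiff x)
  rw [hpar X Y Z hX hY hZ, Pi.zero_apply] at hcov
  linarith

theorem NablaPlusBZero.derivation_dTwo (hpar : G.NablaPlusBZero) {X Y Z : VField E M}
    (hX : SmoothVF X) (hY : SmoothVF Y) (hZ : SmoothVF Z) (x : M) :
    dTwo G.b (G.A.app X) Y Z x + dTwo G.b X (G.A.app Y) Z x + dTwo G.b X Y (G.A.app Z) x =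
      -dTwo G.b X Y Z x := by
  have hcyclic := dTwo_eq_cyclic_covBilin_leviCivita G.g G.b_swap (hX.mdiff x) (hY.mdiff x)
    (hZ.mdiff x)
  rw [hpar.covBilin_leviCivita hX hY hZ, hpar.covBilin_leviCivita hY hZ hX,
    hpar.covBilin_leviCivita hZ hX hY, dTwo_swap G.b_swap X Z, dTwo_swap G.b_swap Y X,
    dTwo_swap G.b_swap Z Y, dTwo_cycle _ Z X, ← dTwo_cycle _ (G.A.app X) Y Z] at hcyclic
  linarith

theorem NablaPlusBZero.dTwoAt_eq_zero [T2Space M] (hpar : G.NablaPlusBZero) (x : M) :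
    dTwoAt G.b_smooth G.b_swap x = 0 := by
  let : RiemannianBundle (TangentSpace 𝓘(ℝ, E) : M → Type _) := ⟨G.g.toRiemannianMetric⟩
  have : FiniteDimensional ℝ (TangentSpace 𝓘(ℝ, E) x) := inferInstanceAs (FiniteDimensional ℝ E)
  have hskew (v : TangentSpace 𝓘(ℝ, E) x) : inner ℝ (G.A x v) v = 0 :=
    (G.inner_A x v v).trans (G.b_alt x v)
  refine trilinear_eq_zero_of_derivation_eq_mul hskew (c := -1) (by norm_num) fun u v w => ?_
  obtain ⟨X, hX, rfl⟩ := exists_smoothVF_eq x u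
  obtain ⟨Y, hY, rfl⟩ := exists_smoothVF_eq x v
  obtain ⟨Z, hZ, rfl⟩ := exists_smoothVF_eq x w
  have hderiv := hpar.derivation_dTwo hX hY hZ x
  rw [neg_one_mul, dTwoAt_apply _ _ (hX.mdiff x) (hY.mdiff x) (hZ.mdiff x), ← hderiv,
    ← dTwoAt_apply G.b_smooth G.b_swap ((G.smoothEnd_A.app hX).mdiff x) (hY.mdiff x) (hZ.mdiff x),
    ← dTwoAt_apply G.b_smooth G.b_swap (hX.mdiff x) ((G.smoothEnd_A.app hY).mdiff x) (hZ.mdiff x),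
    ← dTwoAt_apply G.b_smooth G.b_swap (hX.mdiff x) (hY.mdiff x) ((G.smoothEnd_A.app hZ).mdiff x)]
  rfl

theorem NablaPlusBZero.dTwo_eq_zero [T2Space M] (hpar : G.NablaPlusBZero) {X Y Z : VField E M}
    {x : M} (hX : MDiffAt (T% X) x) (hY : MDiffAt (T% Y) x) (hZ : MDiffAt (T% Z) x) :
    dTwo G.b X Y Z x = 0 := by
  rw [← dTwoAt_apply G.b_smooth G.b_swap hX hY hZ, hpar.dTwoAt_eq_zero]
  rfl

theorem NablaPlusBZero.covBilin_leviCivita_eq_zero [T2Space M] (hpar : G.NablaPlusBZero)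
    {X Y Z : VField E M} (hX : SmoothVF X) (hY : SmoothVF Y) (hZ : SmoothVF Z) :
    covBilin G.g.leviCivita G.b X Y Z = 0 := by
  funext x
  rw [hpar.covBilin_leviCivita hX hY hZ,
    hpar.dTwo_eq_zero (hX.mdiff x) (hZ.mdiff x) (G.smoothEnd_A.mdiff_app (hY.mdiff x)),
    hpar.dTwo_eq_zero (hX.mdiff x) (hY.mdiff x) (G.smoothEnd_A.mdiff_app (hZ.mdiff x))]
  simp

theorem NablaPlusBZero.covEnd_leviCivita_eq_zero [T2Space M] (hpar : G.NablaPlusBZero)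
    {X Y : VField E M} (hX : SmoothVF X) (hY : SmoothVF Y) :
    covEnd G.g.leviCivita G.A X Y = 0 := by
  funext x
  refine (G.g.inner_bijective x).1 (ContinuousLinearMap.ext fun v => ?_)
  obtain ⟨Z, hZ, rfl⟩ := exists_smoothVF_eq x v
  rw [G.inner_covEnd_leviCivita (hX.mdiff x) (hY.mdiff x) (hZ.mdiff x),
    hpar.covBilin_leviCivita_eq_zero hX hY hZ]
  simp

theorem NonDegenerate.bijective_A (hb : G.NonDegenerate) (x : M) : Function.Bijective (G.A x) := by
  have : FiniteDimensional ℝ (TangentSpace 𝓘(ℝ, E) x) := inferInstanceAs (FiniteDimensional ℝ E)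
  have hinj : Function.Injective (G.A x) := by
    refine (injective_iff_map_eq_zero (G.A x)).mpr fun v hv => hb x v fun w => ?_
    rw [← G.inner_A, hv, map_zero, zero_apply]
  exact ⟨hinj, (LinearMap.injective_iff_surjective (f := (G.A x).toLinearMap)).mp hinj⟩

variable (G) in
theorem fundForm_A : G.g.fundForm G.A = G.b := by
  funext x
  ext v w
  exact G.inner_A x v w

end GeneralizedMetric

end GenGeom

open GenGeom

theorem mainTheorem12_general {E : Type*} [NormedAddCommGroup E] [NormedSpace ℝ E]
    [FiniteDimensional ℝ E] {M : Type*} [TopologicalSpace M] [ChartedSpace E M]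
    [IsManifold 𝓘(ℝ, E) ∞ M] [T2Space M]
    (n : ℕ) (hn : 4 ≤ 2 * n) (hdim : Module.finrank ℝ E = 2 * n)
    (G : GeneralizedMetric E M)
    (hb : G.NonDegenerate)
    (hpar : G.NablaPlusBZero) :
    IsWeakNearlyKahler G.g G.A G.Q where
  dim := ⟨n, by lia, hdim⟩
  smooth := G.smoothEnd_A
  skew x v w := by rw [G.inner_A, G.b_eq_neg_inner_A]
  nonsingular := hb.bijective_A
  Q_eq _ _ := rfl
  covEnd_eq_zero _ hX := hpar.covEnd_leviCivita_eq_zero hX hX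
  covFundForm_eq_zero _ _ hX hY := by
    rw [G.fundForm_A, hpar.covBilin_leviCivita_eq_zero hX hX hY]

theorem mainTheorem12 {E : Type*} [NormedAddCommGroup E] [NormedSpace ℝ E] [FiniteDimensional ℝ E]
    {M : Type*} [TopologicalSpace M] [ChartedSpace E M] [IsManifold 𝓘(ℝ, E) ∞ M]
    [T2Space M] [SecondCountableTopology M]
    (n : ℕ) (hn : 4 ≤ 2 * n) (hdim : Module.finrank ℝ E = 2 * n)
    (G : GeneralizedMetric E M)
    (hb : G.NonDegenerate)
    (hpar : G.NablaPlusBZero)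
    (hid : ∀ X Y Z : VField E M, SmoothVF X → SmoothVF Y → SmoothVF Z → ∀ x : M,
      G.b x (G.sharpD X (G.A.app Y) x - G.sharpD (G.A.app X) Y x) (Z x)
        + G.b x (G.sharpD (G.A.app Y) Z x) (X x)
        - G.b x (G.sharpD Y Z x) (G.A x (X x))
        - G.b x (G.sharpD Z (G.A.app X) x) (Y x)
        + G.b x (G.sharpD Z X x) (G.A x (Y x)) = 0) :
    IsWeakNearlyKahler G.g G.A G.Q :=
  mainTheorem12_general n hn hdim G hb hpar
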